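/- A deterministic $k$-round $\mathsf{BIS}$-query algorithm on the vertex set $V=\{1,\dots,n\}$ accesses an unknown undirected multigraph $G$ on $V$ only as follows. In each of $k$ rounds it asks simultaneously a finite list of queries $\mathsf{BIS}(A,B)$, where $A,B\subseteq V$ are disjoint and the answer says whether $G$ has an edge with one endpoint in $A$ and the other in $B$; the queries of a round depend only on the queries and answers of the previous rounds (there may be none in a round), and the output depends only on the queries and answers of all $k$ rounds. A spanning forest of $G$ is an acyclic set of pairs of vertices, each of which is joined by an edge of $G$, that connects any two vertices lying in the same connected component of $G$. Theorem. Let $r$ be a positive integer. There is a constant $C$, depending only on $r$, such that for every $n$ there is a deterministic $35r$-round $\mathsf{BIS}$-query algorithm that, on every undirected multigraph $G$ on the vertex set $\{1,\dots,n\}$, makes at most $C\,n^{1+1/r}\log n$ $\mathsf{BIS}$-queries in each round and returns a spanning forest of $G$. -/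

import Mathlib

/-- The record of a run: for each round performed so far, in order, the list of the queries made
in that round, each together with the answer it received. -/
abbrev Transcript (Q R : Type*) : Type _ := List (List (Q × R))

/-- A deterministic round-based query algorithm with queries in `Q`, answers in `R` and outputs
in `O`. The queries of a round are all asked at once and are determined by the transcript of the
previous rounds; the output is determined by the transcript of all rounds. -/
structure RoundAlgorithm (Q R O : Type*) where
  /-- the number of rounds -/
  rounds : ℕ
  /-- the queries of the next round, given the transcript so far -/
  queries : Transcript Q R → List Q
  /-- the output, given the final transcript -/
  output : Transcript Q R → O

namespace RoundAlgorithm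

variable {Q R O : Type*}

/-- The transcript of the first `i` rounds when queries are answered by `oracle`. -/
def transcript (A : RoundAlgorithm Q R O) (oracle : Q → R) : ℕ → Transcript Q R
  | 0 => []
  | i + 1 =>
      transcript A oracle i ++
        [(A.queries (transcript A oracle i)).map fun q => (q, oracle q)]

/-- The number of queries made in round `i` (rounds are numbered `0, …, A.rounds - 1`). -/
def queryCount (A : RoundAlgorithm Q R O) (oracle : Q → R) (i : ℕ) : ℕ :=
  (A.queries (A.transcript oracle i)).length

/-- The output of the algorithm after all its rounds. -/
def run (A : RoundAlgorithm Q R O) (oracle : Q → R) : O :=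
  A.output (A.transcript oracle A.rounds)

end RoundAlgorithm

/-- A bipartite independent set query on the vertex set `V`: two disjoint sets of vertices. -/
structure BISQuery (V : Type*) where
  left : Finset V
  right : Finset V
  disjoint : Disjoint left right

open Classical in
/-- The answer to a bipartite independent set query: is there an edge with one endpoint in the
left set and the other endpoint in the right set? -/
noncomputable def bisOracle {V β : Type*} (G : Graph V β) (q : BISQuery V) : Bool :=
  decide (∃ a ∈ q.left, ∃ b ∈ q.right, G.Adj a b)

/-- `F` is a spanning forest of the multigraph `G` (whose vertex set is all of `V`): it has no
cycles, each of its edges joins two vertices joined by some edge of `G`, and it connects any two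
vertices that are connected in `G`. -/
structure IsSpanningForest {V β : Type*} (G : Graph V β) (F : SimpleGraph V) : Prop where
  acyclic : F.IsAcyclic
  adj_of_adj : ∀ u v : V, F.Adj u v → G.Adj u v
  reachable : ∀ u v : V, Relation.ReflTransGen G.Adj u v → F.Reachable u v

/-! This is Borůvka's method with accelerating phases. The vertices are grouped into fibres known to
be connected. With R = 2r and q about n^(1/R), at most q^(R-a) fibres are still active, that is, may
have outgoing edges. For every active fibre a parallel tree search (`forces_search`) finds q^g
adjacent active fibres, or all if there are fewer. A fibre with a short list has all its edges
explained. Hence after merging, an active class contains a fibre with a full list, so at least q^g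
old active fibres, and a grows to a + g (`PartialForest.merge`). Since fewer active fibres leave
room for more queries per fibre, g is about a/2. The search depth is about R/g, so the depths of the
phases form a geometric series of sum O(R) (`PartialForest.forces`). The phases only record which
pairs of fibres are adjacent. Once at most one fibre is active, the fibres are the components, and
two searches turn every recorded pair into an actual edge (`PartialForest.forces_skeleton`). All
this is argued for the set of graphs consistent with the answers so far; `Forces.exists_algorithm`
extracts the algorithm. -/

section SpanningForest

variable {V : Type*}

/-! ### Knowledge states and algorithms -/

/-- Some edge of `H` has one endpoint in `A` and the other in `B`. -/
def SimpleGraph.Meets (H : SimpleGraph V) (A B : Finset V) : Prop :=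
  ∃ a ∈ A, ∃ b ∈ B, H.Adj a b

open Classical in
/-- The answers to bipartite independent set queries on a simple graph. -/
noncomputable def SimpleGraph.bisAnswer (H : SimpleGraph V) (q : BISQuery V) : Bool :=
  decide (H.Meets q.left q.right)

/-- Starting from the knowledge that the unknown graph lies in `S`, one can reach, in `k` rounds of
at most `B` queries each, a set of graphs that has the property `Good`. -/
def Forces (B : ℕ) (Good : Set (SimpleGraph V) → Prop) : ℕ → Set (SimpleGraph V) → Prop
  | 0, S => Good S
  | k + 1, S => ∃ qs : List (BISQuery V), qs.length ≤ B ∧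
      ∀ H₀ ∈ S, Forces B Good k {H ∈ S | ∀ q ∈ qs, H.bisAnswer q = H₀.bisAnswer q}

theorem Forces.bind {B : ℕ} {P Q : Set (SimpleGraph V) → Prop} {k l : ℕ}
    {S : Set (SimpleGraph V)} (h : Forces B P k S)
    (hPQ : ∀ S' ⊆ S, P S' → Forces B Q l S') : Forces B Q (l + k) S := by
  induction k generalizing S with
  | zero => exact hPQ S subset_rfl h
  | succ k ih =>
    obtain ⟨qs, hqs, h⟩ := h
    exact ⟨qs, hqs, fun H₀ hH₀ => ih (h H₀ hH₀) fun S' hS' =>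
      hPQ S' (hS'.trans fun _ hH => hH.1)⟩

theorem Forces.pad {B : ℕ} {Q : Set (SimpleGraph V) → Prop}
    (hQ : ∀ S S' : Set (SimpleGraph V), S' ⊆ S → Q S → Q S') (k : ℕ)
    {S : Set (SimpleGraph V)} (h : Q S) : Forces B Q k S := by
  induction k generalizing S with
  | zero => exact h
  | succ k ih =>
    exact ⟨[], Nat.zero_le _, fun H₀ _ => ih (hQ _ _ (fun _ hH => hH.1) h)⟩

theorem Forces.mono_rounds {B : ℕ} {Q : Set (SimpleGraph V) → Prop}
    (hQ : ∀ S S' : Set (SimpleGraph V), S' ⊆ S → Q S → Q S') {k l : ℕ} (hkl : k ≤ l)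
    {S : Set (SimpleGraph V)} (h : Forces B Q k S) : Forces B Q l S := by
  obtain ⟨m, rfl⟩ := Nat.exists_eq_add_of_le' hkl
  exact h.bind fun S' _ hS' => Forces.pad hQ m hS'

namespace RoundAlgorithm

variable {Q R O : Type*}

/-- The algorithm that asks `qs` in its first round and then runs the algorithm determined by
the answers. -/
def askThen (k : ℕ) (qs : List Q) (next : List (Q × R) → RoundAlgorithm Q R O) :
    RoundAlgorithm Q R O where
  rounds := k + 1
  queries
    | [] => qs
    | h :: t => (next h).queries t
  output
    | [] => (next []).output []
    | h :: t => (next h).output t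

theorem transcript_askThen (k : ℕ) (qs : List Q) (next : List (Q × R) → RoundAlgorithm Q R O)
    (oracle : Q → R) (i : ℕ) :
    (askThen k qs next).transcript oracle (i + 1) =
      (qs.map fun q => (q, oracle q)) ::
        (next (qs.map fun q => (q, oracle q))).transcript oracle i := by
  induction i with
  | zero => rfl
  | succ i ih =>
    rw [transcript, ih]
    rfl

end RoundAlgorithm

/-- The winning strategy branches on the hidden graph only through its answers, so it can be read as
a decision tree. -/
theorem Forces.exists_algorithm {O : Type*} {B : ℕ} {Spec : SimpleGraph V → O → Prop} {k : ℕ}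
    {S : Set (SimpleGraph V)} (h : Forces B (fun S => ∃ a, ∀ H ∈ S, Spec H a) k S)
    [Nonempty O] :
    ∃ A : RoundAlgorithm (BISQuery V) Bool O, A.rounds = k ∧ ∀ H ∈ S,
      (∀ i < k, A.queryCount H.bisAnswer i ≤ B) ∧ Spec H (A.run H.bisAnswer) := by
  classical
  induction k generalizing S with
  | zero =>
    obtain ⟨a, ha⟩ := h
    exact ⟨⟨0, fun _ => [], fun _ => a⟩, rfl, fun H hH => ⟨fun i hi => absurd hi (by simp), ha H hH⟩⟩
  | succ k ih =>
    obtain ⟨qs, hqs, h⟩ := h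
    have h' : ∀ H₀ : SimpleGraph V, ∃ A : RoundAlgorithm (BISQuery V) Bool O, A.rounds = k ∧
        (H₀ ∈ S → ∀ H ∈ {H ∈ S | ∀ q ∈ qs, H.bisAnswer q = H₀.bisAnswer q},
          (∀ i < k, A.queryCount H.bisAnswer i ≤ B) ∧ Spec H (A.run H.bisAnswer)) := by
      intro H₀
      by_cases hH₀ : H₀ ∈ S
      · obtain ⟨A, hA, hA'⟩ := ih (h H₀ hH₀)
        exact ⟨A, hA, fun _ => hA'⟩
      · exact ⟨⟨k, fun _ => [], fun _ => Classical.arbitrary O⟩, rfl, fun hc => absurd hc hH₀⟩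
    choose A hA hA' using h'
    -- The graph itself is not visible; any graph of `S` giving the same answers selects a
    -- continuation that is valid for it.
    let guess : List (BISQuery V × Bool) → SimpleGraph V := fun a =>
      Classical.epsilon fun H₀ => H₀ ∈ S ∧ (qs.map fun q => (q, H₀.bisAnswer q)) = a
    refine ⟨.askThen k qs fun a => A (guess a), rfl, fun H hH => ?_⟩
    obtain ⟨hgS, hg⟩ : guess (qs.map fun q => (q, H.bisAnswer q)) ∈ S ∧
        (qs.map fun q => (q, (guess (qs.map fun q => (q, H.bisAnswer q))).bisAnswer q)) =
          qs.map fun q => (q, H.bisAnswer q) :=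
      Classical.epsilon_spec (p := fun H₀ : SimpleGraph V => H₀ ∈ S ∧
        (qs.map fun q => (q, H₀.bisAnswer q)) = qs.map fun q => (q, H.bisAnswer q)) ⟨H, hH, rfl⟩
    set H₀ := guess (qs.map fun q => (q, H.bisAnswer q)) with hH₀
    have hmem : H ∈ {H ∈ S | ∀ q ∈ qs, H.bisAnswer q = H₀.bisAnswer q} := by
      refine ⟨hH, fun q hq => ?_⟩
      have := List.map_inj_left.1 hg q hq
      exact (congrArg Prod.snd this).symm
    obtain ⟨h1, h2⟩ := hA' H₀ hgS H hmem
    refine ⟨fun i hi => ?_, ?_⟩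
    · cases i with
      | zero => exact hqs
      | succ i =>
        have := h1 i (by omega)
        rw [RoundAlgorithm.queryCount, RoundAlgorithm.transcript_askThen]
        exact this
    · rw [RoundAlgorithm.run] at h2 ⊢
      rw [hA H₀] at h2
      have : (RoundAlgorithm.askThen k qs fun a => A (guess a)).rounds = k + 1 := rfl
      rw [this, RoundAlgorithm.transcript_askThen]
      exact h2

/-! ### Parallel tree search -/

open Classical in
/-- The query whether there is an edge between `A` and the vertices of `B` outside `A`. -/
noncomputable def BISQuery.between (A B : Finset V) : BISQuery V where
  left := A
  right := B \ A
  disjoint := Finset.disjoint_sdiff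

theorem SimpleGraph.bisAnswer_between (H : SimpleGraph V) {A B : Finset V} (h : Disjoint A B) :
    H.bisAnswer (.between A B) = true ↔ H.Meets A B := by
  classical
  simp [SimpleGraph.bisAnswer, BISQuery.between, Finset.sdiff_eq_self_of_disjoint h.symm]

/-- `N` is a family of sets of blocks, a block being a fibre of the colouring `f` of the targets
`Y j`: for each `i ∈ I`, the set `X i` meets some target in each block of `N i`, and `N i` consists
of exactly `K` blocks, or of at most `K` blocks that contain all targets met by `X i`. -/
def Finds {ι κ : Type*} (I : Finset ι) (X : ι → Finset V) (T : ι → Finset V) (Y : V → Finset V)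
    (f : V → κ) (K : ℕ) (S : Set (SimpleGraph V)) (N : ι → Finset κ) : Prop :=
  ∀ i ∈ I, (N i).card ≤ K ∧ ∀ H ∈ S,
    (∀ p ∈ N i, ∃ j ∈ T i, f j = p ∧ H.Meets (X i) (Y j)) ∧
    ((N i).card = K ∨ ∀ j ∈ T i, H.Meets (X i) (Y j) → f j ∈ N i)

section Search

variable {ι : Type*} (I : Finset ι) (X : ι → Finset V) (T : ι → Finset V) (Y : V → Finset V)

open Classical in
/-- One round of a parallel search, given candidate sets `M i` of blocks. -/
theorem forces_search_round (hdisj : ∀ i ∈ I, ∀ j ∈ T i, Disjoint (X i) (Y j)) (f : V → ℕ)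
    {K m B : ℕ} (hB : I.card * m ≤ B) (S : Set (SimpleGraph V)) (M : ι → Finset ℕ)
    (hM : ∀ i ∈ I, (M i).card ≤ m)
    (hS : ∀ H ∈ S, ∀ i ∈ I,
      (∀ j ∈ T i, H.Meets (X i) (Y j) → f j ∈ M i) ∨
      K ≤ ((M i).filter fun p => ∃ j ∈ T i, f j = p ∧ H.Meets (X i) (Y j)).card) :
    Forces B (fun S => ∃ N : ι → Finset ℕ, Finds I X T Y f K S N) 1 S := by
  refine ⟨I.toList.flatMap fun i => (M i).toList.map fun p =>
    .between (X i) (((T i).filter fun j => f j = p).biUnion Y), ?_, fun H₀ hH₀ => ?_⟩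
  · refine le_trans ?_ hB
    rw [List.length_flatMap]
    refine (List.sum_le_card_nsmul _ m ?_).trans (by simp)
    simpa using hM
  have hdisj' : ∀ i ∈ I, ∀ p, Disjoint (X i)
      (((T i).filter fun j => f j = p).biUnion Y) := by
    intro i hi p
    rw [Finset.disjoint_biUnion_right]
    exact fun j hj => hdisj i hi j (Finset.mem_filter.1 hj).1
  have hpos : ∀ (H : SimpleGraph V) i p, H.Meets (X i)
      (((T i).filter fun j => f j = p).biUnion Y) ↔
      ∃ j ∈ T i, f j = p ∧ H.Meets (X i) (Y j) := by
    intro H i p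
    simp only [SimpleGraph.Meets, Finset.mem_biUnion, Finset.mem_filter]
    grind
  set P : ι → Finset ℕ := fun i =>
    (M i).filter fun p => ∃ j ∈ T i, f j = p ∧ H₀.Meets (X i) (Y j) with hP
  -- Discarding all but `K` met blocks keeps the next level at `K * b` candidates; if fewer than `K`
  -- are met, nothing is lost.
  have hN : ∀ i, ∃ N ⊆ P i, N.card = min K (P i).card := fun i =>
    Finset.exists_subset_card_eq (min_le_right _ _)
  choose N hNP hNcard using hN
  refine ⟨N, fun i hi => ⟨(hNcard i).trans_le (min_le_left _ _), fun H hH => ?_⟩⟩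
  have hsame : ∀ p ∈ M i, (∃ j ∈ T i, f j = p ∧ H.Meets (X i) (Y j)) ↔
      ∃ j ∈ T i, f j = p ∧ H₀.Meets (X i) (Y j) := by
    intro p hp
    rw [← hpos, ← hpos, ← H.bisAnswer_between (hdisj' i hi p),
      ← H₀.bisAnswer_between (hdisj' i hi p), hH.2]
    simp only [List.mem_flatMap, Finset.mem_toList, List.mem_map]
    exact ⟨i, hi, p, hp, rfl⟩
  refine ⟨fun p hp => ?_, ?_⟩
  · have := Finset.mem_filter.1 (hNP i hp)
    exact (hsame p this.1).2 this.2
  · by_cases hK : K ≤ (P i).card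
    · exact .inl ((hNcard i).trans (min_eq_left hK))
    · right
      have hNP' : N i = P i := Finset.eq_of_subset_of_card_le (hNP i)
        (by rw [hNcard i]; omega)
      have hcov : ∀ j ∈ T i, H.Meets (X i) (Y j) → f j ∈ M i := by
        refine (hS H hH.1 i hi).resolve_right fun hc => hK (hc.trans_eq ?_)
        rw [hP, Finset.filter_congr hsame]
      intro j hj hm
      rw [hNP']
      exact Finset.mem_filter.2 ⟨hcov j hj hm, (hsame _ (hcov j hj hm)).1 ⟨j, hj, rfl, hm⟩⟩

/-- Parallel tree search below a given level: the labels carry distinct codes, and `M i` is a set of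
candidate blocks of `b ^ s` consecutive codes. -/
theorem forces_search_level (hdisj : ∀ i ∈ I, ∀ j ∈ T i, Disjoint (X i) (Y j))
    (c : V → ℕ) {b K B : ℕ} (hb : 0 < b) (hB : I.card * (K * b) ≤ B)
    (s : ℕ) (S : Set (SimpleGraph V)) (M : ι → Finset ℕ) (hM : ∀ i ∈ I, (M i).card ≤ K * b)
    (hS : ∀ H ∈ S, ∀ i ∈ I,
      (∀ j ∈ T i, H.Meets (X i) (Y j) → c j / b ^ s ∈ M i) ∨
      ∃ N ⊆ M i, K ≤ N.card ∧ ∀ p ∈ N, ∃ j ∈ T i, c j / b ^ s = p ∧ H.Meets (X i) (Y j)) :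
    Forces B (fun S => ∃ N : ι → Finset ℕ, Finds I X T Y c K S N) (s + 1) S := by
  classical
  induction s generalizing S M with
  | zero =>
    simp only [pow_zero, Nat.div_one] at hS
    exact forces_search_round I X T Y hdisj c hB S M hM fun H hH i hi =>
      (hS H hH i hi).imp_right fun ⟨N, hNM, hK, hN⟩ =>
        hK.trans (Finset.card_le_card fun p hp => Finset.mem_filter.2 ⟨hNM hp, hN p hp⟩)
  | succ s ih =>
    have hround := forces_search_round I X T Y hdisj (fun j => c j / b ^ (s + 1)) (K := K) hB S M hM
      fun H hH i hi => (hS H hH i hi).imp_right fun ⟨N, hNM, hK, hN⟩ =>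
        hK.trans (Finset.card_le_card fun p hp => Finset.mem_filter.2 ⟨hNM hp, hN p hp⟩)
    refine hround.bind fun S' hS' ⟨N, hN⟩ => ?_
    have hblock : ∀ x, x / b ^ (s + 1) = x / b ^ s / b := fun x => by
      rw [pow_succ, Nat.div_div_eq_div_mul]
    have hchild : ∀ i, ∀ x, x / b ∈ N i →
        x ∈ ((N i) ×ˢ Finset.range b).image fun pe => pe.1 * b + pe.2 := fun i x hx =>
      Finset.mem_image.2 ⟨(x / b, x % b), Finset.mem_product.2
        ⟨hx, Finset.mem_range.2 (Nat.mod_lt _ hb)⟩, Nat.div_add_mod' x b⟩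
    have hcard : ∀ i ∈ I,
        (((N i) ×ˢ Finset.range b).image fun pe => pe.1 * b + pe.2).card ≤ K * b := by
      intro i hi
      refine Finset.card_image_le.trans ?_
      rw [Finset.card_product, Finset.card_range]
      exact Nat.mul_le_mul_right _ (hN i hi).1
    have hcand : ∀ H ∈ S', ∀ i ∈ I,
        (∀ j ∈ T i, H.Meets (X i) (Y j) →
          c j / b ^ s ∈ ((N i) ×ˢ Finset.range b).image fun pe => pe.1 * b + pe.2) ∨
        ∃ N' ⊆ ((N i) ×ˢ Finset.range b).image fun pe => pe.1 * b + pe.2, K ≤ N'.card ∧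
          ∀ p ∈ N', ∃ j ∈ T i, c j / b ^ s = p ∧ H.Meets (X i) (Y j) := by
      intro H hH i hi
      obtain ⟨hpos, hK | hall⟩ := (hN i hi).2 H hH
      -- A met block has a met child, and distinct blocks have distinct children, so `K` met
      -- candidates survive.
      · right
        have hpos' : ∀ p ∈ N i, ∃ x, x / b = p ∧
            ∃ j ∈ T i, c j / b ^ s = x ∧ H.Meets (X i) (Y j) := fun p hp => by
          obtain ⟨j, hj, hjp, hm⟩ := hpos p hp
          exact ⟨c j / b ^ s, by rw [← hblock]; exact hjp, j, hj, rfl, hm⟩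
        choose! g hgb hg using hpos'
        refine ⟨(N i).image g, ?_, ?_, ?_⟩
        · intro x hx
          obtain ⟨p, hp, rfl⟩ := Finset.mem_image.1 hx
          exact hchild i _ (by rwa [hgb p hp])
        · rw [Finset.card_image_of_injOn, hK]
          intro p hp p' hp' hpp
          rw [← hgb p hp, ← hgb p' hp', hpp]
        · intro x hx
          obtain ⟨p, hp, rfl⟩ := Finset.mem_image.1 hx
          exact hg p hp
      · left
        exact fun j hj hm => hchild i _ (by rw [← hblock]; exact hall j hj hm)
    exact ih S' _ hcard hcand

/-- Parallel search: in `d + 1` rounds one finds, for each `i ∈ I`, a set of `K` labels `j ∈ T i`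
such that `X i` meets `Y j`, or all such labels if there are fewer. -/
theorem forces_search (hdisj : ∀ i ∈ I, ∀ j ∈ T i, Disjoint (X i) (Y j))
    (c : V → ℕ) (hc : Function.Injective c) {b K B d : ℕ} (hb : 0 < b) (hK : 0 < K)
    (hcd : ∀ j, c j < b ^ d) (hB : I.card * (K * b) ≤ B) (S : Set (SimpleGraph V)) :
    Forces B (fun S => ∃ N : ι → Finset V,
      (∀ i, N i ⊆ T i) ∧ Finds I X T Y id K S N) (d + 1) S := by
  classical
  have h := forces_search_level I X T Y hdisj c hb hB d S (fun _ => {0})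
    (fun _ _ => Nat.mul_pos hK hb)
    (fun _ _ _ _ => .inl fun j _ _ => by simp [Nat.div_eq_of_lt (hcd j)])
  have h' := h.bind (l := 0)
    (Q := fun S => ∃ N : ι → Finset V, (∀ i, N i ⊆ T i) ∧ Finds I X T Y id K S N) ?_
  · simpa using h'
  rintro S' - ⟨N, hN⟩
  -- A witness graph is needed to know that every code in `N i` is the code of a label.
  rcases S'.eq_empty_or_nonempty with rfl | ⟨H₀, hH₀⟩
  · exact ⟨fun _ => ∅, fun _ => Finset.empty_subset _,
      fun i _ => ⟨by simp, fun H hH => absurd hH (Set.notMem_empty H)⟩⟩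
  refine ⟨fun i => (T i).filter fun j => c j ∈ N i, fun i => Finset.filter_subset _ _, fun i hi => ?_⟩
  have himage : ((T i).filter fun j => c j ∈ N i).image c = N i := by
    ext p
    simp only [Finset.mem_image, Finset.mem_filter]
    constructor
    · rintro ⟨j, hj, rfl⟩
      exact hj.2
    · intro hp
      obtain ⟨j, hj, rfl, -⟩ := ((hN i hi).2 H₀ hH₀).1 p hp
      exact ⟨j, ⟨hj, hp⟩, rfl⟩
  have hcard : ((T i).filter fun j => c j ∈ N i).card = (N i).card := by
    conv_rhs => rw [← himage, Finset.card_image_of_injective _ hc]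
  rw [hcard]
  refine ⟨(hN i hi).1, fun H hH => ⟨fun j hj => ?_, ?_⟩⟩
  · rw [Finset.mem_filter] at hj
    obtain ⟨j', hj', hjj, hm⟩ := ((hN i hi).2 H hH).1 _ hj.2
    obtain rfl := hc hjj
    exact ⟨j', hj', rfl, hm⟩
  · exact ((hN i hi).2 H hH).2.imp_right fun hall j hj hm =>
      Finset.mem_filter.2 ⟨hj, hall j hj hm⟩

end Search

/-! ### Partial forests and merging -/

/-- Partial knowledge about the components of the unknown graph: the fibres of `π` are connected by
edges between the pairs in `L`, and only the fibres with labels in `A` may have outgoing edges. -/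
structure PartialForest (q R a : ℕ) (S : Set (SimpleGraph V)) (π : V → V) (A : Finset V)
    (L : Finset (Finset V × Finset V)) : Prop where
  card_active : A.card * q ^ a ≤ q ^ R
  card_pairs : L.card ≤ a * q ^ (R + 1)
  disjoint : ∀ p ∈ L, Disjoint p.1 p.2
  meets : ∀ H ∈ S, ∀ p ∈ L, H.Meets p.1 p.2
  active : ∀ H ∈ S, ∀ u v, H.Adj u v → π u ≠ π v → π u ∈ A
  reachable : ∀ D : SimpleGraph V, (∀ p ∈ L, D.Meets p.1 p.2) → ∀ u v, π u = π v → D.Reachable u v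

/-- The graphs in `S` have a common subgraph with the same connected components as each of them. -/
def HasCommonSkeleton (S : Set (SimpleGraph V)) : Prop :=
  ∃ D : SimpleGraph V, ∀ H ∈ S, D ≤ H ∧ ∀ u v, H.Reachable u v → D.Reachable u v

theorem HasCommonSkeleton.anti (S S' : Set (SimpleGraph V)) (h : S' ⊆ S)
    (hS : HasCommonSkeleton S) : HasCommonSkeleton S' :=
  hS.imp fun _ hD H hH => hD H (h hH)

theorem PartialForest.singletons {q R : ℕ} [Fintype V] (hq : Fintype.card V ≤ q ^ R)
    (S : Set (SimpleGraph V)) : PartialForest q R 0 S id Finset.univ ∅ where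
  card_active := by simpa using hq
  card_pairs := by simp
  disjoint := by simp
  meets := by simp
  active := by simp
  reachable := by
    rintro D - u v rfl
    exact .rfl

open Classical in
/-- Merging the fibres of `π` along found adjacencies. -/
theorem PartialForest.merge [Fintype V] {q R a e : ℕ} {S : Set (SimpleGraph V)} {π : V → V}
    {A : Finset V} {L : Finset (Finset V × Finset V)} (h : PartialForest q R a S π A L)
    (he : 0 < e) (hea : e ≤ a + 1) (hq : 0 < q) {N : V → Finset V}
    (hNT : ∀ i, N i ⊆ A.erase i)
    (hN : Finds A (fun i => Finset.univ.filter (π · = i)) (fun i => A.erase i)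
      (fun j => Finset.univ.filter (π · = j)) id (q ^ e) S N) :
    ∃ π' A' L', PartialForest q R (a + e) S π' A' L' := by
  let F : V → Finset V := fun i => Finset.univ.filter (π · = i)
  let E : SimpleGraph V := SimpleGraph.fromRel fun i j => i ∈ A ∧ j ∈ N i
  let ρ : V → V := fun i => Quot.out (E.connectedComponentMk i)
  have hρ : ∀ i j, ρ i = ρ j ↔ E.Reachable i j := by
    intro i j
    rw [← SimpleGraph.ConnectedComponent.eq]
    refine ⟨fun hij => ?_, fun hij => by simp only [ρ, hij]⟩
    have := congrArg (Quot.mk E.Reachable) hij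
    exact (Quot.out_eq _).symm.trans (this.trans (Quot.out_eq _))
  have hE : ∀ i ∈ A, ∀ j ∈ N i, E.Adj i j := fun i hi j hj => by
    rw [SimpleGraph.fromRel_adj]
    exact ⟨(Finset.ne_of_mem_erase (hNT i hj)).symm, .inl ⟨hi, hj⟩⟩
  -- A list shorter than `q ^ e` is complete, so an edge leaving a merged class starts in a fibre
  -- with a full list.
  let A' : Finset V := (A.filter fun i => (N i).card = q ^ e).image ρ
  let L' : Finset (Finset V × Finset V) :=
    L ∪ A.biUnion fun i => (N i).image fun j => (F i, F j)
  refine ⟨ρ ∘ π, A', L', ?_, ?_, ?_, ?_, ?_, ?_⟩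
  · have hA' : q ^ e * A'.card ≤ A.card := by
      have hsub : A.filter (fun i => ρ i ∈ A') ⊆ A := Finset.filter_subset _ _
      refine le_trans ?_ (Finset.card_le_card hsub)
      refine Finset.mul_card_image_le_card_of_maps_to (f := ρ)
        (fun i hi => (Finset.mem_filter.1 hi).2) _ fun l hl => ?_
      obtain ⟨i, hi, rfl⟩ := Finset.mem_image.1 hl
      rw [Finset.mem_filter] at hi
      rw [← hi.2]
      -- The full list of `i` lies inside the class of `i`, which therefore absorbs `q ^ e` active
      -- fibres.
      refine Finset.card_le_card fun j hj => ?_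
      have hij : ρ j = ρ i := ((hρ i j).2 (hE i hi.1 j hj).reachable).symm
      simp only [Finset.mem_filter]
      exact ⟨⟨Finset.mem_of_mem_erase (hNT i hj), hij ▸ hl⟩, hij⟩
    calc A'.card * q ^ (a + e) = (q ^ e * A'.card) * q ^ a := by ring
      _ ≤ A.card * q ^ a := Nat.mul_le_mul_right _ hA'
      _ ≤ q ^ R := h.card_active
  · have h1 : (A.biUnion fun i => (N i).image fun j => (F i, F j)).card ≤ q ^ (R + 1) := by
      calc (A.biUnion fun i => (N i).image fun j => (F i, F j)).card
          ≤ A.card * q ^ e := Finset.card_biUnion_le_card_mul _ _ _ fun i hi =>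
            Finset.card_image_le.trans (hN i hi).1
        _ ≤ A.card * q ^ (a + 1) := Nat.mul_le_mul_left _ (Nat.pow_le_pow_right hq hea)
        _ = A.card * q ^ a * q := by ring
        _ ≤ q ^ R * q := Nat.mul_le_mul_right _ h.card_active
        _ = q ^ (R + 1) := by ring
    calc L'.card ≤ L.card + _ := Finset.card_union_le _ _
      _ ≤ a * q ^ (R + 1) + q ^ (R + 1) := Nat.add_le_add h.card_pairs h1
      _ = (a + 1) * q ^ (R + 1) := by ring
      _ ≤ (a + e) * q ^ (R + 1) := Nat.mul_le_mul_right _ (by omega)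
  · intro p hp
    rcases Finset.mem_union.1 hp with hp | hp
    · exact h.disjoint p hp
    · simp only [Finset.mem_biUnion, Finset.mem_image] at hp
      obtain ⟨i, hi, j, hj, rfl⟩ := hp
      have hne := Finset.ne_of_mem_erase (hNT i hj)
      rw [Finset.disjoint_left]
      intro x hx hx'
      simp only [F, Finset.mem_filter] at hx hx'
      exact hne (hx'.2.symm.trans hx.2)
  · intro H hH p hp
    rcases Finset.mem_union.1 hp with hp | hp
    · exact h.meets H hH p hp
    · simp only [Finset.mem_biUnion, Finset.mem_image] at hp
      obtain ⟨i, hi, j, hj, rfl⟩ := hp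
      obtain ⟨j', -, rfl, hm⟩ := ((hN i hi).2 H hH).1 j hj
      exact hm
  · intro H hH u v huv hne
    have hne' : π u ≠ π v := fun hc => hne (congrArg ρ hc)
    have hu := h.active H hH u v huv hne'
    have hv := h.active H hH v u huv.symm hne'.symm
    refine Finset.mem_image.2 ⟨π u, Finset.mem_filter.2 ⟨hu, ?_⟩, rfl⟩
    refine ((hN _ hu).2 H hH).2.resolve_right fun hall => hne ?_
    exact (hρ _ _).2 (hE _ hu _ (hall _ (Finset.mem_erase.2 ⟨hne'.symm, hv⟩)
      ⟨u, by simp, v, by simp, huv⟩)).reachable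
  · intro D hD
    have hmeets : ∀ i j, E.Adj i j → ∃ x y, π x = i ∧ π y = j ∧ D.Adj x y := by
      have key : ∀ i ∈ A, ∀ j ∈ N i, ∃ x y, π x = i ∧ π y = j ∧ D.Adj x y := by
        intro i hi j hj
        obtain ⟨x, hx, y, hy, hxy⟩ := hD (F i, F j) (Finset.mem_union_right _
          (Finset.mem_biUnion.2 ⟨i, hi, Finset.mem_image_of_mem _ hj⟩))
        exact ⟨x, y, (Finset.mem_filter.1 hx).2, (Finset.mem_filter.1 hy).2, hxy⟩
      intro i j hij
      rcases ((SimpleGraph.fromRel_adj _ _ _).1 hij).2 with ⟨hi, hj⟩ | ⟨hj, hi⟩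
      · exact key i hi j hj
      · obtain ⟨x, y, hx, hy, hxy⟩ := key j hj i hi
        exact ⟨y, x, hy, hx, hxy.symm⟩
    have hold := h.reachable D fun p hp => hD p (Finset.mem_union_left _ hp)
    have hwalk : ∀ i j (w : E.Walk i j) u v, π u = i → π v = j → D.Reachable u v := by
      intro i j w
      induction w with
      | nil => exact fun u v hu hv => hold u v (hu.trans hv.symm)
      | cons hadj _ ih =>
        intro u v hu hv
        obtain ⟨x, y, hx, hy, hxy⟩ := hmeets _ _ hadj
        exact ((hold u x (hu.trans hx.symm)).trans hxy.reachable).trans (ih y v hy hv)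
    intro u v huv
    obtain ⟨w⟩ := (hρ _ _).1 huv
    exact hwalk _ _ w u v rfl rfl

/-! ### Recovering edges and counting rounds -/

/-- Once at most one fibre can have outgoing edges, actual edges between the recorded pairs are
recovered by two searches. -/
theorem PartialForest.forces_skeleton {q R a B : ℕ} {S : Set (SimpleGraph V)} {π : V → V}
    {A : Finset V} {L : Finset (Finset V × Finset V)} (h : PartialForest q R a S π A L)
    (hA : A.card ≤ 1) (hq : 0 < q) (c : V → ℕ) (hc : Function.Injective c)
    (hcq : ∀ v, c v < q ^ R) (hB : a * q ^ (R + 2) ≤ B) :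
    Forces B HasCommonSkeleton ((R + 1) + (R + 1)) S := by
  have hLB : L.card * (1 * q) ≤ B := by
    refine le_trans ?_ hB
    calc L.card * (1 * q) = L.card * q := by ring
      _ ≤ a * q ^ (R + 1) * q := Nat.mul_le_mul_right _ h.card_pairs
      _ = a * q ^ (R + 2) := by ring
  refine (forces_search L (fun p => p.2) (fun p => p.1) (fun v => {v})
    (fun p hp v hv => ?_) c hc hq one_pos hcq hLB S).bind fun S₁ hS₁ ⟨N, hNT, hN⟩ => ?_
  · rw [Finset.disjoint_singleton_right]
    exact Finset.disjoint_left.1 (h.disjoint p hp) hv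
  refine Nat.zero_add (R + 1) ▸ (forces_search L N (fun p => p.2) (fun v => {v})
    (fun p hp v hv => ?_) c hc hq one_pos hcq hLB S₁).bind
      (l := 0) fun S₂ hS₂ ⟨N', hNT', hN'⟩ => ?_
  · rw [Finset.disjoint_singleton_right]
    exact fun hv' => Finset.disjoint_left.1 (h.disjoint p hp) (hNT p hv') hv
  -- The first search fixes one endpoint per pair, the second a neighbour of it on the other side.
  let D : SimpleGraph V := SimpleGraph.fromRel fun x y => ∃ p ∈ L, x ∈ N p ∧ y ∈ N' p
  refine ⟨D, fun H hH => ?_⟩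
  have hHS₁ := hS₂ hH
  have hHS := hS₁ hHS₁
  have hedge : ∀ p ∈ L, ∀ x ∈ N p, ∀ y ∈ N' p, H.Adj x y := by
    intro p hp x hx y hy
    obtain ⟨y', -, rfl, x', hx', z, hz, hxz⟩ := ((hN' p hp).2 H hH).1 y hy
    rw [Finset.mem_singleton] at hz
    rw [Finset.card_le_one.1 (hN p hp).1 x hx x' hx']
    exact hz ▸ hxz
  have hne : ∀ p ∈ L, (N p).Nonempty ∧ (N' p).Nonempty := by
    intro p hp
    have hx : ∃ x ∈ N p, H.Meets p.2 {x} := by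
      obtain ⟨x, hx, y, hy, hxy⟩ := h.meets H hHS p hp
      have hNe : (N p).Nonempty := by
        rcases ((hN p hp).2 H hHS₁).2 with h1 | hall
        · exact Finset.card_pos.1 (h1 ▸ one_pos)
        · exact ⟨x, hall x hx ⟨y, hy, x, Finset.mem_singleton_self x, hxy.symm⟩⟩
      obtain ⟨x, hx⟩ := hNe
      obtain ⟨x', -, rfl, hm⟩ := ((hN p hp).2 H hHS₁).1 x hx
      exact ⟨_, hx, hm⟩
    obtain ⟨x, hx, y, hy, z, hz, hyz⟩ := hx
    obtain rfl := Finset.mem_singleton.1 hz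
    have hNe : (N' p).Nonempty := by
      rcases ((hN' p hp).2 H hH).2 with h1 | hall
      · exact Finset.card_pos.1 (h1 ▸ one_pos)
      · exact ⟨y, hall y hy ⟨z, hx, y, Finset.mem_singleton_self y, hyz.symm⟩⟩
    exact ⟨⟨z, hx⟩, hNe⟩
  have hDreach := h.reachable D fun p hp => by
    obtain ⟨⟨x, hx⟩, y, hy⟩ := hne p hp
    exact ⟨x, hNT p hx, y, hNT' p hy, (SimpleGraph.fromRel_adj _ _ _).2
      ⟨(hedge p hp x hx y hy).ne, .inl ⟨p, hp, hx, hy⟩⟩⟩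
  refine ⟨fun x y hxy => ?_, fun u v huv => ?_⟩
  · rcases ((SimpleGraph.fromRel_adj _ _ _).1 hxy).2 with ⟨p, hp, hx, hy⟩ | ⟨p, hp, hx, hy⟩
    · exact hedge p hp x hx y hy
    · exact (hedge p hp y hx x hy).symm
  · obtain ⟨w⟩ := huv
    induction w with
    | nil => exact .rfl
    | cons hadj _ ih =>
      refine SimpleGraph.Reachable.trans (hDreach _ _ ?_) ih
      by_contra hne
      exact hne (Finset.card_le_one.1 hA _ (h.active H hHS _ _ hadj hne) _
        (h.active H hHS _ _ hadj.symm (Ne.symm hne)))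

/-- The number of rounds needed decreases geometrically with the phases. -/
theorem PartialForest.forces [Fintype V] {q R a B : ℕ} {S : Set (SimpleGraph V)} {π : V → V}
    {A : Finset V} {L : Finset (Finset V × Finset V)} (h : PartialForest q R a S π A L)
    (ha : a ≤ 2 * R) (hR : 0 < R) (hq : 0 < q) (c : V → ℕ) (hc : Function.Injective c)
    (hcq : ∀ v, c v < q ^ R) (hB : 2 * R * q ^ (R + 2) ≤ B) :
    Forces B HasCommonSkeleton ((R + 1) + (R + 1) + 12 * R / (a + 1)) S := by
  classical
  induction hm : 2 * R - a using Nat.strong_induction_on generalizing a S π A L with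
  | _ m ih =>
  rcases le_or_gt R a with hRa | hRa
  · have hA : A.card ≤ 1 := by
      have hpow := h.card_active.trans (Nat.pow_le_pow_right hq hRa)
      exact Nat.le_of_mul_le_mul_right (by simpa using hpow) (pow_pos hq a)
    exact (h.forces_skeleton hA hq c hc hcq ((Nat.mul_le_mul_right _ ha).trans hB)).mono_rounds
      HasCommonSkeleton.anti (Nat.le_add_right _ _)
  -- List length and branching are both `q ^ g`, so a round costs `q ^ (2 * g)` per active fibre; `2
  -- * g ≤ a + 2` fits the budget.
  set g := a / 2 + 1 with hg
  have hcd : ∀ v, c v < (q ^ g) ^ (R / g + 1) := fun v => by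
    refine (hcq v).trans_le ?_
    rw [← pow_mul]
    exact Nat.pow_le_pow_right hq (Nat.lt_mul_div_succ R (by omega)).le
  have hAB : A.card * (q ^ g * q ^ g) ≤ B := by
    calc A.card * (q ^ g * q ^ g) = A.card * q ^ (g + g) := by rw [pow_add q g g]
      _ ≤ A.card * q ^ (a + 2) := Nat.mul_le_mul_left _ (Nat.pow_le_pow_right hq (by omega))
      _ = A.card * q ^ a * q ^ 2 := by ring
      _ ≤ q ^ R * q ^ 2 := Nat.mul_le_mul_right _ h.card_active
      _ = 1 * q ^ (R + 2) := by ring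
      _ ≤ 2 * R * q ^ (R + 2) := Nat.mul_le_mul_right _ (by omega)
      _ ≤ B := hB
  have hphase := (forces_search A (fun i => Finset.univ.filter (π · = i)) (fun i => A.erase i)
    (fun j => Finset.univ.filter (π · = j)) (fun i _ j hj => ?_) c hc (pow_pos hq g)
    (pow_pos hq g) hcd hAB S).bind (Q := HasCommonSkeleton)
    (l := (R + 1) + (R + 1) + 12 * R / (a + g + 1)) fun S' hS' ⟨N, hNT, hN⟩ => ?_
  · refine hphase.mono_rounds HasCommonSkeleton.anti ?_
    rw [add_assoc]
    refine Nat.add_le_add_left ?_ _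
    -- Multiplied by `a + 1`, the later phases contribute at most `8 * R`, the search depth `2 * R`
    -- and the two extra rounds `2 * R`: hence the constant 12.
    rw [Nat.le_div_iff_mul_le (by omega)]
    have h1 : 12 * R / (a + g + 1) * (a + g + 1) ≤ 12 * R := Nat.div_mul_le_self _ _
    have h2 : R / g * g ≤ R := Nat.div_mul_le_self _ _
    generalize 12 * R / (a + g + 1) = t at h1 ⊢
    generalize R / g = d at h2 ⊢
    have h3 : t * (3 * (a + 1)) ≤ t * (2 * (a + g + 1)) := Nat.mul_le_mul_left _ (by omega)
    have h4 : d * (a + 1) ≤ d * (2 * g) := Nat.mul_le_mul_left _ (by omega)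
    nlinarith
  · rw [Finset.disjoint_left]
    intro x hx hx'
    rw [Finset.mem_filter] at hx hx'
    exact Finset.ne_of_mem_erase hj (hx'.2.symm.trans hx.2)
  · have h' : PartialForest q R a S' π A L :=
      { h with
        meets := fun H hH => h.meets H (hS' hH)
        active := fun H hH => h.active H (hS' hH) }
    obtain ⟨π', A', L', hmerge⟩ := h'.merge (by omega) (by omega) hq hNT hN
    exact ih (2 * R - (a + g)) (by omega) hmerge (by omega) rfl

theorem forces_hasCommonSkeleton [Fintype V] {q R B : ℕ} (hR : 0 < R) (hq : 0 < q) (c : V → ℕ)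
    (hc : Function.Injective c) (hcq : ∀ v, c v < q ^ R) (hV : Fintype.card V ≤ q ^ R)
    (hB : 2 * R * q ^ (R + 2) ≤ B) (S : Set (SimpleGraph V)) :
    Forces B HasCommonSkeleton (14 * R + 2) S := by
  have h := (PartialForest.singletons hV S).forces (Nat.zero_le _) hR hq c hc hcq hB
  convert h using 1
  simp
  omega

/-! ### From simple graphs back to multigraphs -/

/-- The simple graph underlying a multigraph. -/
def Graph.underlying {β : Type*} (G : Graph V β) : SimpleGraph V where
  Adj u v := u ≠ v ∧ G.Adj u v
  symm := ⟨fun _ _ h => ⟨h.1.symm, h.2.symm⟩⟩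
  loopless := ⟨fun _ h => h.1 rfl⟩

/-- Queries have disjoint sides, so loops never influence an answer. -/
theorem Graph.bisAnswer_underlying {β : Type*} (G : Graph V β) :
    G.underlying.bisAnswer = bisOracle G := by
  classical
  funext q
  simp only [SimpleGraph.bisAnswer, bisOracle, SimpleGraph.Meets, Graph.underlying]
  congr 1
  rw [eq_iff_iff]
  constructor
  · rintro ⟨a, ha, b, hb, -, hab⟩
    exact ⟨a, ha, b, hb, hab⟩
  · rintro ⟨a, ha, b, hb, hab⟩
    exact ⟨a, ha, b, hb, fun h => Finset.disjoint_left.1 q.disjoint ha (h ▸ hb), hab⟩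

theorem Graph.isSpanningForest_of_underlying {β : Type*} (G : Graph V β) {F : SimpleGraph V}
    (hF : F.IsAcyclic) (hle : F ≤ G.underlying)
    (hreach : ∀ u v, G.underlying.Reachable u v → F.Reachable u v) : IsSpanningForest G F where
  acyclic := hF
  adj_of_adj u v huv := (hle huv).2
  reachable u v huv := by
    refine hreach u v ?_
    induction huv with
    | refl => exact .rfl
    | @tail b c _ hbc ih =>
      by_cases h : b = c
      · exact h ▸ ih
      · exact ih.trans (SimpleGraph.Adj.reachable (G := G.underlying) ⟨h, hbc⟩)

theorem exists_spanningForest_algorithm [Fintype V] {q R : ℕ} (hR : 0 < R) (hq : 0 < q)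
    (c : V → ℕ) (hc : Function.Injective c) (hcq : ∀ v, c v < q ^ R)
    (hV : Fintype.card V ≤ q ^ R) {k : ℕ} (hk : 14 * R + 2 ≤ k) :
    ∃ A : RoundAlgorithm (BISQuery V) Bool (SimpleGraph V), A.rounds = k ∧
      ∀ (β : Type*) (G : Graph V β),
        (∀ i < k, A.queryCount (bisOracle G) i ≤ 2 * R * q ^ (R + 2)) ∧
        IsSpanningForest G (A.run (bisOracle G)) := by
  have h := (forces_hasCommonSkeleton hR hq c hc hcq hV le_rfl Set.univ).mono_rounds
    HasCommonSkeleton.anti hk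
  obtain ⟨A, hA, hspec⟩ := (h.bind (l := 0) (Q := fun S => ∃ F : SimpleGraph V, ∀ H ∈ S,
    F.IsAcyclic ∧ F ≤ H ∧ ∀ u v, H.Reachable u v → F.Reachable u v)
    fun S' _ ⟨D, hD⟩ => by
      obtain ⟨F, -, hFD, hF, hreach⟩ :=
        SimpleGraph.exists_isAcyclic_reachable_eq_le_of_le_of_isAcyclic
          (bot_le : ⊥ ≤ D) SimpleGraph.isAcyclic_bot
      exact ⟨F, fun H hH => ⟨hF, hFD.trans (hD H hH).1, fun u v huv =>
        hreach ▸ (hD H hH).2 u v huv⟩⟩).exists_algorithm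
  refine ⟨A, hA.trans (Nat.zero_add k), fun β G => ?_⟩
  obtain ⟨hcount, hF, hle, hreach⟩ := hspec G.underlying (Set.mem_univ _)
  rw [G.bisAnswer_underlying] at hcount hF hle hreach
  exact ⟨fun i hi => hcount i (by omega), G.isSpanningForest_of_underlying hF hle hreach⟩

end SpanningForest

/-! ### Choice of parameters -/

theorem exists_root_bound (r : ℕ) (hr : 0 < r) (n : ℕ) (hn : 0 < n) :
    ∃ q : ℕ, 0 < q ∧ n ≤ q ^ (2 * r) ∧
      (q : ℝ) ^ (2 * r + 2) ≤ 2 ^ (2 * r + 2) * (n : ℝ) ^ (1 + 1 / (r : ℝ)) := by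
  have hn1 : (1 : ℝ) ≤ n := by exact_mod_cast hn
  have hr0 : (r : ℝ) ≠ 0 := by exact_mod_cast hr.ne'
  set x : ℝ := (n : ℝ) ^ (1 / (2 * r : ℝ)) with hx
  have hx1 : 1 ≤ x := Real.one_le_rpow hn1 (by positivity)
  have hpow : ∀ m : ℕ, x ^ m = (n : ℝ) ^ ((m : ℝ) / (2 * r)) := fun m => by
    rw [hx, ← Real.rpow_mul_natCast (by positivity)]
    congr 1
    ring
  refine ⟨⌈x⌉₊, Nat.ceil_pos.2 (by linarith), ?_, ?_⟩
  · have h1 : x ^ (2 * r) = n := by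
      rw [hpow]
      push_cast
      rw [div_self (by positivity), Real.rpow_one]
    have h2 : x ^ (2 * r) ≤ (⌈x⌉₊ : ℝ) ^ (2 * r) := by
      gcongr
      exact Nat.le_ceil x
    rw [h1] at h2
    exact_mod_cast h2
  -- Rounding up costs at most a factor 2 because `1 ≤ x`.
  · have h1 : (⌈x⌉₊ : ℝ) ≤ 2 * x := by
      have := Nat.ceil_lt_add_one (show 0 ≤ x by linarith)
      linarith
    calc (⌈x⌉₊ : ℝ) ^ (2 * r + 2) ≤ (2 * x) ^ (2 * r + 2) := by gcongr
      _ = 2 ^ (2 * r + 2) * (n : ℝ) ^ (1 + 1 / (r : ℝ)) := by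
        rw [mul_pow, hpow]
        congr 2
        push_cast
        field_simp

theorem mainTheorem3 (r : ℕ) (hr : 0 < r) :
    ∃ C : ℝ, ∀ n : ℕ,
      ∃ A : RoundAlgorithm (BISQuery (Fin n)) Bool (SimpleGraph (Fin n)),
        A.rounds = 35 * r ∧
        ∀ (β : Type*) (G : Graph (Fin n) β), G.vertexSet = Set.univ →
          (∀ i < A.rounds, (A.queryCount (bisOracle G) i : ℝ) ≤
            C * (n : ℝ) ^ (1 + 1 / (r : ℝ)) * Real.log n) ∧
          IsSpanningForest G (A.run (bisOracle G)) := by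
  -- The search needs no logarithmic factor; dividing by `Real.log 2` absorbs `Real.log n` for `2 ≤
  -- n`.
  refine ⟨4 * r * 2 ^ (2 * r + 2) / Real.log 2, fun n => ?_⟩
  -- Here `Real.log n = 0`, so no query is allowed, and the empty forest suffices.
  rcases le_or_gt n 1 with hn | hn
  · have hsub : Subsingleton (Fin n) := Fin.subsingleton_iff_le_one.2 hn
    refine ⟨⟨35 * r, fun _ => [], fun _ => ⊥⟩, rfl, fun β G _ => ⟨fun i _ => ?_, ?_⟩⟩
    · have hlog : Real.log n = 0 := by
        interval_cases n <;> simp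
      simp [RoundAlgorithm.queryCount, hlog]
    · exact ⟨SimpleGraph.isAcyclic_bot, fun u v h => h.elim,
        fun u v _ => Subsingleton.elim u v ▸ .rfl⟩
  · obtain ⟨q, hq, hnq, hqn⟩ := exists_root_bound r hr n (by omega)
    -- With `R = 2 * r`, the bound `q ^ (R + 2)` is of order n^(1 + 2/R) = n^(1 + 1/r).
    obtain ⟨A, hA, hspec⟩ := exists_spanningForest_algorithm (V := Fin n) (R := 2 * r)
      (by omega) hq Fin.val Fin.val_injective (fun v => v.2.trans_le hnq) (by simpa using hnq)
      (show 14 * (2 * r) + 2 ≤ 35 * r by omega)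
    refine ⟨A, hA, fun β G _ => ⟨fun i hi => ?_, (hspec β G).2⟩⟩
    have hcount := (hspec β G).1 i (hA ▸ hi)
    have hlog2 : 0 < Real.log 2 := Real.log_pos one_lt_two
    have hlog : Real.log 2 ≤ Real.log n :=
      Real.log_le_log two_pos (by exact_mod_cast hn)
    calc (A.queryCount (bisOracle G) i : ℝ)
        ≤ ((2 * (2 * r) * q ^ (2 * r + 2) : ℕ) : ℝ) := by exact_mod_cast hcount
      _ = 4 * r * (q : ℝ) ^ (2 * r + 2) := by push_cast; ring
      _ ≤ 4 * r * (2 ^ (2 * r + 2) * (n : ℝ) ^ (1 + 1 / (r : ℝ))) := by gcongr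
      _ = 4 * r * 2 ^ (2 * r + 2) / Real.log 2 * (n : ℝ) ^ (1 + 1 / (r : ℝ)) * Real.log 2 := by
        field_simp
      _ ≤ 4 * r * 2 ^ (2 * r + 2) / Real.log 2 * (n : ℝ) ^ (1 + 1 / (r : ℝ)) * Real.log n := by
        gcongr
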